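/- **Setting.** Let $\Gamma\subset\mathbb R^d$ be a finite, connected, oriented network with vertices $\{x_i\}_{i\in I}$ and arcs $\{e_j\}_{j\in J}$. Each arc has a smooth injective parametrization $\pi_j$, compatible with the orientation, on $[0,L_j]$ (bounded arc), on $[0,\infty)$ (unbounded arc originating from a vertex) or on $(-\infty,0]$ (unbounded arc terminating in a vertex). Arcs meet only at vertices and contain no vertices besides their endpoints. There are no sinks, i.e. every vertex has an outgoing arc; a vertex without incoming arcs is called a source, and each source has exactly one outgoing arc. $\mathcal S$ denotes the set of sources, $d_\Gamma$ the minimum path distance (path length measured in the parameters), $\mathcal M^+$ the finite positive measures, and $\|\cdot\|_{BL}^*$ the dual of the norm $\|\phi\|_\infty+|\phi|_{Lip}$. Fix $o\in\Gamma$; the $q$-moment of $m\in\mathcal M^+(\Gamma)$ is $\langle m,d^q\rangle=\int_\Gamma d_\Gamma(y,o)^q\,dm(y)$. Let $T>0$ and let the following be given: an initial measure $m_0=\sum_j m_0^j\in\mathcal M^+(\Gamma)$ with $m_0^j$ carried by $e_j$; a boundary measure $\sigma_0=\sum_{x_i\in\mathcal S}\sigma_0^i$ with $\sigma_0^i\in\mathcal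 M^+(\{x_i\}\times[0,T])$; coefficients $p_{kj}\in BV([0,T];[0,1])$ such that $p_{kj}=0$ unless the end of $e_k$ is the beginning of $e_j$, and $\sum_j p_{kj}(t)=1$ for every arc $e_k$ that ends in a vertex; and, for $m\in\mathcal M^+(\Gamma)$, a velocity $v[m]$ defined on each arc, with $0\le v\le V_{max}$ ($V_{max}>0$), such that for some $L$, $|v[m](x)-v[m](y)|\le L|x-y|$ for $x,y$ in the same arc (with $|x-y|$ measured in the parameter) and $|v[m_1](x)-v[m_2](x)|\le L\|m_1-m_2\|^*_{BL}$. For $N\in\mathbb N$ set $t_n=nT/2^N$. An approximation $m^N:[0,T]\to\mathcal M^+(\Gamma)$, $m^N_t=\sum_j m^{N,j}_t$, is a map with $m^N_0=m_0$ which on every interval $[t_n,t_{n+1})$, $0\le n<2^N$, is a measure-valued solution of the linear transport problem with frozen velocity $w=v[m^N_{t_n}]$. This means: $m^N_t\otimes dt$ is a finite measure; for all $t\in[t_n,t_{n+1}]$ and all test functions $f$ (functions on $\Gamma\times\mathbb R$, smooth on each closed arc, vanishing far away on the unbounded arcs) $$\langle m^N_t,f(\cdot,t)\rangle-\langle m^N_{t_n},f(\cdot,t_n)\rangle=\sum_{x_i\in\mathcal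 S}\int_{[t_n,t)}f(x_i,s)\,d\sigma^i_0(s)+\int_{t_n}^{t}\langle m^N_s,(\partial_t+w\,\partial_x)f(\cdot,s)\rangle\,ds ;$$ and there are finite measures in time (the traces of $m^N$ at the endpoints of the arcs, identified by the corresponding balance on each single arc) such that, at each vertex $x_i\notin\mathcal S$ and for each arc $e_j$ outgoing from $x_i$, the inflow trace of $e_j$ on $[t_n,t_{n+1})$ equals $\sum_k p_{kj}\cdot(\text{outflow trace of }e_k)$, summed over the arcs $e_k$ incoming in $x_i$. **Proposition.** If $m_0$ has finite $q$-moments for $q=1,2$, then so has every $m^N_t$, $t\in[0,T]$, $N\in\mathbb N$. Moreover there is a positive constant $C=C(T,V_{max},\|m_0\|_{BL}^*,\|\sigma_0\|_{BL}^*)$ (depending otherwise only on the network $\Gamma$ and the base point $o$) such that $$\langle m^N_t,d^q\rangle\le C\,\bigl(1+\langle m_0,d^q\rangle\bigr),\qquad q=1,2,$$ for every $t\in[0,T]$ and every $N\in\mathbb N$. -/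

import Mathlib

open MeasureTheory Set
open scoped ContDiff ENNReal

noncomputable section

/-- The three kinds of oriented arcs: an arc of length `L` from the vertex `a` to the vertex `b`,
parametrized on `[0, L]`; an unbounded arc originating from `a`, parametrized on `[0, ∞)`; an
unbounded arc terminating in `b`, parametrized on `(-∞, 0]`. -/
inductive ArcShape (V : Type*) where
  | segment (a b : V) (L : ℝ) : ArcShape V
  | rayOut (a : V) : ArcShape V
  | rayIn (b : V) : ArcShape V

namespace ArcShape

variable {V : Type*}

/-- Parameter interval of the arc. -/
def dom : ArcShape V → Set ℝ
  | segment _ _ L => Icc 0 L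
  | rayOut _ => Ici 0
  | rayIn _ => Iic 0

/-- Initial vertex, if any. It always has parameter `0`. -/
def tail : ArcShape V → Option V
  | segment a _ _ => some a
  | rayOut a => some a
  | rayIn _ => none

/-- Terminal vertex, if any. -/
def head : ArcShape V → Option V
  | segment _ b _ => some b
  | rayOut _ => none
  | rayIn b => some b

/-- Parameter of the terminal vertex (irrelevant if there is none). -/
def headParam : ArcShape V → ℝ
  | segment _ _ L => L
  | rayOut _ => 0
  | rayIn _ => 0

end ArcShape

/-- A finite connected oriented network in `ℝ^d` without sinks, such that each source has exactly
one outgoing arc. The arcs do not cross themselves, and meet each other only at vertices. -/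
structure Network (d : ℕ) (V J : Type*) where
  pos : V → EuclideanSpace ℝ (Fin d)
  pos_injective : Function.Injective pos
  shape : J → ArcShape V
  length_pos : ∀ j a b L, shape j = ArcShape.segment a b L → 0 < L
  param : J → ℝ → EuclideanSpace ℝ (Fin d)
  param_smooth : ∀ j, ContDiffOn ℝ ∞ (param j) (shape j).dom
  param_injOn : ∀ j, InjOn (param j) (shape j).dom
  param_tail : ∀ j i, (shape j).tail = some i → param j 0 = pos i
  param_head : ∀ j i, (shape j).head = some i → param j (shape j).headParam = pos i
  /-- Distinct arcs meet only at vertices. -/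
  arcs_meet : ∀ j k, j ≠ k → ∀ s ∈ (shape j).dom, ∀ r ∈ (shape k).dom,
    param j s = param k r → ∃ i, param j s = pos i
  /-- An arc contains no vertices other than its endpoints. -/
  vertex_on_arc : ∀ j i, ∀ s ∈ (shape j).dom, param j s = pos i →
    ((shape j).tail = some i ∧ s = 0) ∨ ((shape j).head = some i ∧ s = (shape j).headParam)
  connected : ∀ i i' : V, Relation.EqvGen
    (fun a b => ∃ j, (shape j).tail = some a ∧ (shape j).head = some b) i i'
  /-- There are no sinks. -/
  no_sink : ∀ i, ∃ j, (shape j).tail = some i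
  /-- A source has only one outgoing arc. -/
  source_unique : ∀ i, (∀ j, (shape j).head ≠ some i) → ∃! j, (shape j).tail = some i

namespace Network

variable {d : ℕ} {V J : Type*} (G : Network d V J)

/-- Parameter interval of the arc `j`. -/
abbrev dom (j : J) : Set ℝ := (G.shape j).dom

/-- The points of the network: the union of its arcs. (Each vertex lies on an arc.) -/
def Pt : Type := {x : EuclideanSpace ℝ (Fin d) // ∃ j, ∃ s ∈ G.dom j, G.param j s = x}

/-- The Borel structure of the network. -/
instance : MeasurableSpace G.Pt :=
  inferInstanceAs (MeasurableSpace
    {x : EuclideanSpace ℝ (Fin d) // ∃ j, ∃ s ∈ G.dom j, G.param j s = x})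

/-- The parametrization of the arc `j`, as a map into the network. -/
def arc (j : J) (s : G.dom j) : G.Pt := ⟨G.param j s, j, s, s.2, rfl⟩

theorem zero_mem_dom (j : J) : (0 : ℝ) ∈ G.dom j := by
  cases h : G.shape j with
  | segment a b L =>
    have := G.length_pos j a b L h
    simp [dom, h, ArcShape.dom, this.le]
  | rayOut a => simp [dom, h, ArcShape.dom]
  | rayIn b => simp [dom, h, ArcShape.dom]

/-- The vertex `i` as a point of the network. -/
def vertex (i : V) : G.Pt :=
  ⟨G.pos i, (G.no_sink i).choose, 0, G.zero_mem_dom _, G.param_tail _ _ (G.no_sink i).choose_spec⟩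

/-- `PathLength x y l`: there is a path on the network from `x` to `y`, composed of finitely many
pieces of arcs (travelled in either direction), with total length `l`. -/
inductive PathLength : G.Pt → G.Pt → ℝ → Prop
  | refl (x : G.Pt) : PathLength x x 0
  | step (j : J) (s r : G.dom j) (y : G.Pt) (l : ℝ) (h : PathLength (G.arc j r) y l) :
      PathLength (G.arc j s) y (|(s : ℝ) - r| + l)

/-- The minimum path distance on the network. -/
def pathDist (x y : G.Pt) : ℝ := sInf {l | G.PathLength x y l}

/-- A source is a vertex without incoming arcs. -/
def Source : Type _ := {i : V // ∀ j, (G.shape j).head ≠ some i}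

instance [Finite V] : Finite G.Source :=
  inferInstanceAs (Finite {i : V // ∀ j, (G.shape j).head ≠ some i})

instance [Finite V] : Fintype G.Source := Fintype.ofFinite _

/-- A finite positive measure on the network in the form `m = ∑ j, m j`, where `m j` lives on the
arc `j` (and is written in the parameter of this arc). -/
abbrev ArcMeasures : Type _ := ∀ j, FiniteMeasure (G.dom j)

/-- The measure on the network with the components `m j`. -/
def total [Fintype J] (m : G.ArcMeasures) : FiniteMeasure G.Pt :=
  ∑ j, (m j).map (G.arc j)

/-- The `q`-moment centered at `o`, as an extended nonnegative number. -/
def moment (q : ℕ) (o : G.Pt) (m : FiniteMeasure G.Pt) : ℝ≥0∞ :=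
  ∫⁻ y, ENNReal.ofReal (G.pathDist y o ^ q) ∂(m : Measure G.Pt)

end Network

/-- The dual bounded Lipschitz norm of a functional `F` on functions on a space with distance
`dist`: the supremum of `|F φ|` over all `φ` with `‖φ‖_∞ + |φ|_Lip ≤ 1`. -/
def blNorm {X : Type*} (dist : X → X → ℝ) (F : (X → ℝ) → ℝ) : ℝ :=
  sSup {r | ∃ (φ : X → ℝ) (A B : ℝ), 0 ≤ A ∧ 0 ≤ B ∧ A + B ≤ 1 ∧ (∀ x, |φ x| ≤ A) ∧
    (∀ x y, |φ x - φ y| ≤ B * dist x y) ∧ r = |F φ|}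

namespace Network

variable {d : ℕ} {V J : Type*} (G : Network d V J)

/-- Dual bounded Lipschitz norm of a positive measure on the network. -/
def normBL (m : FiniteMeasure G.Pt) : ℝ :=
  blNorm G.pathDist (fun φ => ∫ x, φ x ∂(m : Measure G.Pt))

/-- Dual bounded Lipschitz norm of a difference of positive measures on the network. -/
def normBLDiff (m₁ m₂ : FiniteMeasure G.Pt) : ℝ :=
  blNorm G.pathDist
    (fun φ => ∫ x, φ x ∂(m₁ : Measure G.Pt) - ∫ x, φ x ∂(m₂ : Measure G.Pt))

/-- Dual bounded Lipschitz norm of the boundary measure `∑ i, δ_{x_i} ⊗ σ i`, on the product of the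
network with `[0, T]`. -/
def normBLBoundary [Finite V] {T : ℝ} (σ : G.Source → FiniteMeasure (Icc (0 : ℝ) T)) : ℝ :=
  blNorm (fun z w : G.Pt × Icc (0 : ℝ) T => G.pathDist z.1 w.1 + |(z.2 : ℝ) - w.2|)
    (fun φ => ∑ i, ∫ t, φ (G.vertex i.1, t) ∂(σ i : Measure (Icc (0 : ℝ) T)))

/-- A nonlocal velocity field `v[m]`, given on each arc (it may jump at vertices): nonnegative,
bounded by `Vmax`, Lipschitz continuous along each arc uniformly in the measure, and Lipschitz
continuous in the measure uniformly in the point. -/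
structure IsVelocityField [Fintype J] (Vmax : ℝ)
    (v : FiniteMeasure G.Pt → ∀ j, G.dom j → ℝ) : Prop where
  nonneg : ∀ m j s, 0 ≤ v m j s
  le_max : ∀ m j s, v m j s ≤ Vmax
  lipschitz : ∃ L : ℝ,
    (∀ m j (s r : G.dom j), |v m j s - v m j r| ≤ L * |(s : ℝ) - r|) ∧
    (∀ m₁ m₂ j s, |v m₁ j s - v m₂ j s| ≤ L * G.normBLDiff m₁ m₂)

/-- A distribution matrix on `[0, T]`: `p k j t` is the fraction of the mass at the end of the arc
`k` that enters the arc `j` at time `t`. -/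
structure IsDistributionMatrix [Fintype J] (T : ℝ) (p : J → J → ℝ → ℝ) : Prop where
  mem_Icc : ∀ k j, ∀ t ∈ Icc 0 T, p k j t ∈ Icc (0 : ℝ) 1
  /-- Each arc with a terminal vertex hands on all its mass. -/
  sum_eq_one : ∀ k i, (G.shape k).head = some i → ∀ t ∈ Icc 0 T, ∑ j, p k j t = 1
  /-- Mass passes from `k` to `j` only if the end of `k` is the beginning of `j`. -/
  eq_zero : ∀ k j, (¬ ∃ i, (G.shape k).head = some i ∧ (G.shape j).tail = some i) →
    ∀ t ∈ Icc 0 T, p k j t = 0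
  bv : ∀ k j, BoundedVariationOn (p k j) (Icc 0 T)

/-- Test functions: functions of a point of the network and of the time that are smooth on each
(closed) arc and vanish far away on the unbounded arcs. Here `ext j` is a smooth extension of the
function on the arc `j` to all values of the parameter. -/
structure TestFunction where
  toFun : G.Pt → ℝ → ℝ
  ext : J → ℝ → ℝ → ℝ
  ext_smooth : ∀ j, ContDiff ℝ ∞ (fun z : ℝ × ℝ => ext j z.1 z.2)
  ext_support : ∃ R, ∀ j s t, R < |s| → ext j s t = 0
  toFun_arc : ∀ j (s : G.dom j) t, toFun (G.arc j s) t = ext j s t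

/-- The transport operator `∂_t ψ + w ∂_x ψ` at the parameter `s` and the time `t`, where `w` is the
velocity there. -/
def transportOp (ψ : ℝ → ℝ → ℝ) (w s t : ℝ) : ℝ :=
  deriv (fun τ => ψ s τ) t + w * deriv (fun r => ψ r t) s

/-- `m` solves, on the arc `j` and for `a ≤ t ≤ b`, the linear transport equation with velocity `w`
in which mass enters at the beginning of the arc according to `μin` and leaves at its end
according to `μout` (measures in time). This identifies `μin` and `μout` as the traces of `m` at
the endpoints of the arc. -/
structure HasTraces (j : J) (w : G.dom j → ℝ) (a b : ℝ)
    (m : ℝ → FiniteMeasure (G.dom j)) (μin μout : FiniteMeasure ℝ) : Prop where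
  in_eq_zero : (G.shape j).tail = none → μin = 0
  out_eq_zero : (G.shape j).head = none → μout = 0
  balance : ∀ ψ : ℝ → ℝ → ℝ, ContDiff ℝ ∞ (fun z : ℝ × ℝ => ψ z.1 z.2) →
    (∃ R, ∀ s t, R < |s| → ψ s t = 0) → ∀ t ∈ Icc a b,
      ∫ s : G.dom j, ψ s t ∂(m t : Measure (G.dom j))
          - ∫ s : G.dom j, ψ s a ∂(m a : Measure (G.dom j))
        = ∫ τ in Ico a t, ψ 0 τ ∂(μin : Measure ℝ)
          - ∫ τ in Ico a t, ψ (G.shape j).headParam τ ∂(μout : Measure ℝ)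
          + ∫ τ in a..t, ∫ s : G.dom j, transportOp ψ (w s) s τ ∂(m τ : Measure (G.dom j))

/-- `m` is a measure-valued solution on `[a, b)` of the linear transport problem on the network with
velocity `w`, distribution matrix `p`, boundary measure `σ` (restricted to `[a, b)`) and initial
mass distribution `m a`. The final condition `t = b` is included. -/
structure IsLinearSolution [Finite V] [Fintype J] [DecidableEq V] {T : ℝ} (p : J → J → ℝ → ℝ)
    (σ : G.Source → FiniteMeasure (Icc (0 : ℝ) T)) (w : ∀ j, G.dom j → ℝ) (a b : ℝ)
    (m : ℝ → G.ArcMeasures) : Prop where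
  /-- `m t ⊗ dt` is a finite measure on the product of the network with `[a, b)`. -/
  aemeasurable : ∀ j, AEMeasurable (fun t => (m t j : Measure (G.dom j)))
    (volume.restrict (Ico a b))
  finite : ∀ j, ∫⁻ t in Ico a b, (m t j : Measure (G.dom j)) univ < ⊤
  /-- The weak form of the transport equation with sources. -/
  balance : ∀ f : G.TestFunction, ∀ t ∈ Icc a b,
    ∫ x, f.toFun x t ∂(G.total (m t) : Measure G.Pt)
        - ∫ x, f.toFun x a ∂(G.total (m a) : Measure G.Pt)
      = ∑ i, ∫ τ in {τ : Icc (0 : ℝ) T | a ≤ (τ : ℝ) ∧ (τ : ℝ) < t}, f.toFun (G.vertex i.1) τ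
            ∂(σ i : Measure (Icc (0 : ℝ) T))
        + ∫ τ in a..t, ∑ j, ∫ s : G.dom j, transportOp (f.ext j) (w j s) s τ
            ∂(m τ j : Measure (G.dom j))
  /-- The transmission conditions at the vertices which are not sources. -/
  transmission : ∃ μin μout : J → FiniteMeasure ℝ,
    (∀ j, G.HasTraces j (w j) a b (fun t => m t j) (μin j) (μout j)) ∧
    ∀ i : V, (∃ k, (G.shape k).head = some i) → ∀ j, (G.shape j).tail = some i →
      (μin j : Measure ℝ).restrict (Ico a b)
        = ∑ k with (G.shape k).head = some i,
            ((μout k : Measure ℝ).restrict (Ico a b)).withDensity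
              (fun t => ENNReal.ofReal (p k j t))

/-- `m` is the `N`-th semi-discrete-in-time approximation on `[0, T]`: on each of the `2 ^ N`
intervals `[n T / 2 ^ N, (n + 1) T / 2 ^ N)` it solves the linear transport problem whose velocity
is frozen at the distribution at the beginning of the interval. -/
structure IsApproximation [Finite V] [Fintype J] [DecidableEq V] {T : ℝ}
    (v : FiniteMeasure G.Pt → ∀ j, G.dom j → ℝ) (p : J → J → ℝ → ℝ) (m₀ : G.ArcMeasures)
    (σ : G.Source → FiniteMeasure (Icc (0 : ℝ) T)) (N : ℕ) (m : ℝ → G.ArcMeasures) : Prop where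
  initial : m 0 = m₀
  step : ∀ n : ℕ, n < 2 ^ N →
    G.IsLinearSolution p σ (v (G.total (m (n * (T / 2 ^ N)))))
      (n * (T / 2 ^ N)) ((n + 1) * (T / 2 ^ N)) m

end Network

end

/-!
The moments are compared with one weight that decreases along every trajectory of speed at most
`Vmax`. Let `escape` be the distance travelled into an unbounded arc (and `0` on bounded arcs). Up to
additive constants it is the distance to `o`: see `Network.exists_pathDist_le_escape_add`, which
uses connectedness, and `Network.exists_escape_le_pathDist_add`, which uses that an unbounded arc
can be left only through its vertex. The weight is `W ^ q` with
`W = K + escape + Vmax * (T - t)`: since `escape` changes at most at speed `Vmax` along a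
trajectory, `(∂_t + w ∂_x) W ≤ 0` for each velocity `0 ≤ w ≤ Vmax`; and at the vertices `W`
depends only on the time, so that it is one function on the network.

To be a test function the weight has to vanish far away. On arcs going out to infinity a fixed
decreasing cutoff keeps the sign. On arcs coming in from infinity mass moves towards larger values
of a fixed cutoff, so the cutoff is made to shrink in time faster than the mass can move
(`ArcShape.cutParam`, `ArcShape.transportOp_barrier_nonpos`). The weak form of the transport equation
then says that the integral of the cut-off weight grows at most by the mass entering at the sources
times `(K + Vmax * T) ^ q`, the largest value of the weight there. This needs no information on the velocity beyond
`0 ≤ w ≤ Vmax`, so it adds up over the time steps without loss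
(`Network.IsApproximation.barrierMass_le`), and monotone convergence removes the cutoff
(`Network.lintegral_weight_le`). Testing with the constant `1` bounds the initial mass and the
boundary mass by their dual bounded Lipschitz norms (`le_blNorm`).
-/

/-! ### Glueing along the vertices, and the path distance -/

namespace ArcShape

/-- Distance from the point with parameter `s` to the vertex of the arc if the arc is unbounded,
and `0` if it is bounded. -/
def escape {V : Type*} : ArcShape V → ℝ → ℝ
  | segment _ _ _, _ => 0
  | rayOut _, s => s
  | rayIn _, s => -s

theorem escape_nonneg {V : Type*} (A : ArcShape V) {s : ℝ} (hs : s ∈ A.dom) : 0 ≤ A.escape s := by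
  cases A <;> simp_all [dom, escape]

theorem escape_tail {V : Type*} (A : ArcShape V) {i : V} (_ : A.tail = some i) :
    A.escape 0 = 0 := by
  cases A <;> simp [escape]

theorem escape_head {V : Type*} (A : ArcShape V) {i : V} (_ : A.head = some i) :
    A.escape A.headParam = 0 := by
  cases A <;> simp_all [escape, headParam, head]

theorem abs_escape_sub_le {V : Type*} (A : ArcShape V) (s r : ℝ) :
    |A.escape s - A.escape r| ≤ |s - r| := by
  cases A
  · simp [escape]
  · simp [escape]
  · simp only [escape]
    rw [abs_sub_comm s r, neg_sub_neg]

end ArcShape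

namespace Network

variable {d : ℕ} {V J : Type*} (G : Network d V J)

/-- Functions given on the single arcs glue to a function on the network as soon as they agree at
the vertices. -/
theorem exists_glue {α : Type*} (g : J → ℝ → α) (c : V → α)
    (htail : ∀ j i, (G.shape j).tail = some i → g j 0 = c i)
    (hhead : ∀ j i, (G.shape j).head = some i → g j (G.shape j).headParam = c i) :
    ∃ h : G.Pt → α, ∀ j (s : G.dom j), h (G.arc j s) = g j s := by
  have hvert : ∀ j i, ∀ s ∈ G.dom j, G.param j s = G.pos i → g j s = c i := by
    intro j i s hs h
    rcases G.vertex_on_arc j i s hs h with ⟨h1, rfl⟩ | ⟨h1, rfl⟩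
    · exact htail j i h1
    · exact hhead j i h1
  have key : ∀ j k, ∀ s ∈ G.dom j, ∀ r ∈ G.dom k, G.param j s = G.param k r → g j s = g k r := by
    intro j k s hs r hr h
    by_cases hjk : j = k
    · subst hjk
      rw [G.param_injOn j hs hr h]
    · obtain ⟨i, hi⟩ := G.arcs_meet j k hjk s hs r hr h
      rw [hvert j i s hs hi, hvert k i r hr (h ▸ hi)]
  refine ⟨fun x => g x.2.choose x.2.choose_spec.choose, fun j s => ?_⟩
  have hx := (G.arc j s).2.choose_spec.choose_spec
  exact key _ _ _ hx.1 _ s.2 hx.2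

theorem headParam_mem_dom {j : J} {i : V} (h : (G.shape j).head = some i) :
    (G.shape j).headParam ∈ G.dom j := by
  cases hj : G.shape j with
  | segment a b L =>
    have := G.length_pos j a b L hj
    simp [dom, hj, ArcShape.dom, ArcShape.headParam, this.le]
  | rayOut a => simp [hj, ArcShape.head] at h
  | rayIn b => simp [dom, hj, ArcShape.dom, ArcShape.headParam]

theorem measurableSet_dom (j : J) : MeasurableSet (G.dom j) := by
  unfold dom
  cases G.shape j with
  | segment a b L => exact measurableSet_Icc
  | rayOut a => exact measurableSet_Ici
  | rayIn b => exact measurableSet_Iic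

theorem measurableEmbedding_arc (j : J) : MeasurableEmbedding (G.arc j) := by
  have : StandardBorelSpace (G.dom j) := (G.measurableSet_dom j).standardBorel
  let X := {x : EuclideanSpace ℝ (Fin d) // ∃ j, ∃ s ∈ G.dom j, G.param j s = x}
  have hc : Continuous (fun s : G.dom j => (⟨G.param j s, j, s, s.2, rfl⟩ : X)) :=
    (continuousOn_iff_continuous_domRestrict.1 (G.param_smooth j).continuousOn).subtype_mk _
  refine Measurable.measurableEmbedding (α := X) hc.measurable fun s r h => ?_
  exact Subtype.ext (G.param_injOn j s.2 r.2 (congrArg Subtype.val h))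

theorem PathLength.nonneg {x y : G.Pt} {l : ℝ} (h : G.PathLength x y l) : 0 ≤ l := by
  induction h with
  | refl => exact le_rfl
  | step j s r y l _ ih => positivity

theorem pathDist_nonneg (x y : G.Pt) : 0 ≤ G.pathDist x y :=
  Real.sInf_nonneg fun _ h => PathLength.nonneg G h

theorem pathDist_le {x y : G.Pt} {l : ℝ} (h : G.PathLength x y l) : G.pathDist x y ≤ l :=
  csInf_le ⟨0, fun _ h => PathLength.nonneg G h⟩ h

theorem PathLength.trans {x y z : G.Pt} {l l' : ℝ} (h : G.PathLength x y l)
    (h' : G.PathLength y z l') : G.PathLength x z (l + l') := by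
  induction h with
  | refl => simpa using h'
  | step j s r y l _ ih => simpa only [add_assoc] using PathLength.step j s r z _ (ih h')

theorem pathLength_arc (j : J) (s r : G.dom j) :
    G.PathLength (G.arc j s) (G.arc j r) |(s : ℝ) - r| := by
  simpa using PathLength.step j s r _ _ (PathLength.refl (G.arc j r))

theorem PathLength.symm {x y : G.Pt} {l : ℝ} (h : G.PathLength x y l) : G.PathLength y x l := by
  induction h with
  | refl x => exact PathLength.refl x
  | step j s r y l _ ih =>
    have := ih.trans G (G.pathLength_arc j r s)
    rwa [abs_sub_comm, add_comm] at this

theorem arc_tail {j : J} {i : V} (h : (G.shape j).tail = some i) :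
    G.arc j ⟨0, G.zero_mem_dom j⟩ = G.vertex i :=
  Subtype.ext (G.param_tail j i h)

theorem arc_head {j : J} {i : V} (h : (G.shape j).head = some i) :
    G.arc j ⟨_, G.headParam_mem_dom h⟩ = G.vertex i :=
  Subtype.ext (G.param_head j i h)

theorem exists_pathLength_vertex (i i' : V) :
    ∃ l, G.PathLength (G.vertex i) (G.vertex i') l := by
  induction G.connected i i' with
  | rel a b h =>
    obtain ⟨j, ha, hb⟩ := h
    rw [← G.arc_tail ha, ← G.arc_head hb]
    exact ⟨_, G.pathLength_arc _ _ _⟩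
  | refl a => exact ⟨0, PathLength.refl _⟩
  | symm a b _ ih => exact ih.imp fun _ h => h.symm G
  | trans a b c _ _ ih ih' =>
    obtain ⟨l, h⟩ := ih
    obtain ⟨l', h'⟩ := ih'
    exact ⟨_, h.trans G h'⟩

theorem exists_pathLength_to_vertex (j : J) (s : G.dom j) :
    ∃ i l, G.PathLength (G.arc j s) (G.vertex i) l := by
  cases hj : G.shape j with
  | segment a b L =>
    have h : (G.shape j).tail = some a := by rw [hj]; rfl
    exact ⟨a, _, G.arc_tail h ▸ G.pathLength_arc j s _⟩
  | rayOut a =>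
    have h : (G.shape j).tail = some a := by rw [hj]; rfl
    exact ⟨a, _, G.arc_tail h ▸ G.pathLength_arc j s _⟩
  | rayIn b =>
    have h : (G.shape j).head = some b := by rw [hj]; rfl
    exact ⟨b, _, G.arc_head h ▸ G.pathLength_arc j s _⟩

/-- Connectedness: any two points of the network are joined by a path, so that `pathDist` is the
infimum of a nonempty set. -/
theorem exists_pathLength (x y : G.Pt) : ∃ l, G.PathLength x y l := by
  obtain ⟨_, j, s, hs, rfl⟩ := x
  obtain ⟨_, k, r, hr, rfl⟩ := y
  obtain ⟨i, l, h⟩ := G.exists_pathLength_to_vertex j ⟨s, hs⟩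
  obtain ⟨i', l', h'⟩ := G.exists_pathLength_to_vertex k ⟨r, hr⟩
  obtain ⟨l'', h''⟩ := G.exists_pathLength_vertex i i'
  exact ⟨_, (h.trans G h'').trans G (h'.symm G)⟩

/-- On a bounded arc the parameter is bounded, so the distance to `o` is controlled by the
distance travelled into an unbounded arc. -/
theorem exists_pathDist_le_escape_add [Finite J] (o : G.Pt) :
    ∃ K : ℝ, 1 ≤ K ∧ ∀ j (s : G.dom j), G.pathDist (G.arc j s) o ≤ (G.shape j).escape s + K := by
  have hj : ∀ j, ∃ K : ℝ, ∀ s : G.dom j,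
      G.pathDist (G.arc j s) o ≤ (G.shape j).escape s + K := by
    intro j
    obtain ⟨l, hl⟩ := G.exists_pathLength (G.arc j ⟨0, G.zero_mem_dom j⟩) o
    have hd : ∀ s : G.dom j, G.pathDist (G.arc j s) o ≤ |(s : ℝ)| + l := fun s => by
      simpa using G.pathDist_le (PathLength.step j s _ _ _ hl)
    cases hs : G.shape j with
    | segment a b L =>
      refine ⟨L + l, fun s => (hd s).trans ?_⟩
      have h2 : (s : ℝ) ∈ (G.shape j).dom := s.2
      rw [hs] at h2
      simp only [ArcShape.escape, zero_add]
      rw [abs_of_nonneg h2.1]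
      linarith [h2.2]
    | rayOut a =>
      refine ⟨l, fun s => (hd s).trans ?_⟩
      have h2 : (s : ℝ) ∈ (G.shape j).dom := s.2
      rw [hs] at h2
      simp only [ArcShape.escape]
      rw [abs_of_nonneg h2]
    | rayIn a =>
      refine ⟨l, fun s => (hd s).trans ?_⟩
      have h2 : (s : ℝ) ∈ (G.shape j).dom := s.2
      rw [hs] at h2
      simp only [ArcShape.escape]
      rw [abs_of_nonpos h2]
  choose K hK using hj
  obtain ⟨B, hB⟩ := (Set.finite_range K).bddAbove
  exact ⟨max B 1, le_max_right _ _, fun j s => (hK j s).trans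
    (by gcongr; exact (hB (mem_range_self j)).trans (le_max_left _ _))⟩

/-- A path can leave an unbounded arc only through its vertex: `escape` is a function on
the network that changes along a path by at most the length of the path. -/
theorem exists_escape_le_pathDist_add (o : G.Pt) :
    ∃ K : ℝ, 0 ≤ K ∧ ∀ j (s : G.dom j), (G.shape j).escape s ≤ G.pathDist (G.arc j s) o + K := by
  obtain ⟨h, hh⟩ := G.exists_glue (fun j s => (G.shape j).escape s) (fun _ => 0)
    (fun j i hi => (G.shape j).escape_tail hi) (fun j i hi => (G.shape j).escape_head hi)
  have hpath : ∀ x y l, G.PathLength x y l → |h x - h y| ≤ l := by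
    intro x y l hl
    induction hl with
    | refl => simp
    | step j s r y l _ ih =>
      refine (abs_sub_le _ (h (G.arc j r)) _).trans (add_le_add ?_ ih)
      rw [hh, hh]
      exact (G.shape j).abs_escape_sub_le s r
  refine ⟨|h o|, abs_nonneg _, fun j s => ?_⟩
  rw [← hh j s, ← sub_le_iff_le_add]
  refine le_csInf (G.exists_pathLength _ _) fun l hl => ?_
  linarith [(abs_le.1 (hpath _ _ _ hl)).2, le_abs_self (h o)]

end Network

/-! ### The cut-off weight -/

namespace ArcShape

variable {V : Type*}

/-- The quantity `y` in whose square the test functions are cut off. Far away, `y ^ 2` increases in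
time along trajectories of nonnegative bounded velocity; on an arc coming in from infinity this is
the effect of the factor `1 + (1 + t) ^ 2`, which increases for `t ≥ 0`. As this factor is at least
`1` and `y` vanishes at the vertex of an unbounded arc, for all `t`, the cut-off functions have
bounded support in space and are unaffected by the cutoff at that vertex. -/
def cutParam : ArcShape V → ℝ → ℝ → ℝ
  | segment _ _ _, s, _ => s
  | rayOut _, s, _ => s
  | rayIn _, s, t => s * (1 + (1 + t) ^ 2)

/-- The weight `(K + escape + Vmax (T - t)) ^ q`, cut off where `cutParam ^ 2` runs from `R` to
`R + 1`. -/
noncomputable def barrier (A : ArcShape V) (K Vmax T R : ℝ) (q : ℕ) (s t : ℝ) : ℝ :=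
  (K + A.escape s + Vmax * (T - t)) ^ q * Real.smoothTransition (R + 1 - A.cutParam s t ^ 2)

variable (A : ArcShape V) {K Vmax T R : ℝ} {q : ℕ}

theorem contDiff_barrier : ContDiff ℝ ∞ (fun z : ℝ × ℝ => A.barrier K Vmax T R q z.1 z.2) := by
  unfold barrier
  refine ContDiff.mul ?_ (Real.smoothTransition.contDiff.comp ?_)
  · cases A <;> simp only [escape] <;> fun_prop
  · cases A <;> simp only [cutParam] <;> fun_prop

theorem sq_le_cutParam_sq (s t : ℝ) : s ^ 2 ≤ A.cutParam s t ^ 2 := by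
  cases A
  · exact le_rfl
  · exact le_rfl
  · simp only [cutParam, mul_pow]
    exact le_mul_of_one_le_right (sq_nonneg s) (one_le_pow₀ (by nlinarith [sq_nonneg (1 + t)]))

theorem barrier_eq_zero (hR : 0 ≤ R) {s : ℝ} (hs : R + 1 < |s|) (t : ℝ) :
    A.barrier K Vmax T R q s t = 0 := by
  have h1 : R + 1 ≤ s ^ 2 := by
    rw [← sq_abs]
    nlinarith
  rw [barrier, Real.smoothTransition.zero_of_nonpos (by linarith [A.sq_le_cutParam_sq s t]),
    mul_zero]

/-- Decay of a cut-off weight along a transport direction: `W ^ q * θ (R + 1 - y ^ 2)`, where `θ`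
is monotone and constant on `[1, ∞)`, decreases if `W` decreases and `y ^ 2` increases wherever it
exceeds `R`. -/
theorem transportOp_mul_smoothTransition_nonpos {W y : ℝ → ℝ → ℝ} {w s t Ws Wt ys yt : ℝ}
    (hWs : HasDerivAt (fun r => W r t) Ws s) (hWt : HasDerivAt (fun τ => W s τ) Wt t)
    (hys : HasDerivAt (fun r => y r t) ys s) (hyt : HasDerivAt (fun τ => y s τ) yt t)
    (hW : 0 ≤ W s t) (hdW : Wt + w * Ws ≤ 0)
    (hy : R < y s t ^ 2 → 0 ≤ y s t * (yt + w * ys)) :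
    Network.transportOp
      (fun s t => W s t ^ q * Real.smoothTransition (R + 1 - y s t ^ 2)) w s t ≤ 0 := by
  have hθ : ∀ x, HasDerivAt Real.smoothTransition (deriv Real.smoothTransition x) x := fun x =>
    ((Real.smoothTransition.contDiff (n := 1)).differentiable one_ne_zero x).hasDerivAt
  have hs := (hWs.fun_pow q).fun_mul ((hθ _).comp s ((hys.fun_pow 2).const_sub (R + 1)))
  have ht := (hWt.fun_pow q).fun_mul ((hθ _).comp t ((hyt.fun_pow 2).const_sub (R + 1)))
  simp only [Function.comp_apply] at hs ht
  rw [Network.transportOp, hs.deriv, ht.deriv]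
  set θ' := deriv Real.smoothTransition (R + 1 - y s t ^ 2) with hθ'
  have h0 : 0 ≤ θ' := Real.smoothTransition.monotone.deriv_nonneg
  have h1 : 0 ≤ θ' * (y s t * (yt + w * ys)) := by
    by_cases h : R < y s t ^ 2
    · exact mul_nonneg h0 (hy h)
    · -- where the cutoff equals one it is maximal, so its derivative vanishes
      have : θ' = 0 := by
        refine IsLocalMax.deriv_eq_zero (Filter.Eventually.of_forall fun x => ?_)
        rw [Real.smoothTransition.one_of_one_le (x := R + 1 - y s t ^ 2) (by linarith)]
        exact Real.smoothTransition.le_one x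
      rw [this, zero_mul]
  have h2 := mul_nonneg (pow_nonneg hW q) h1
  have h3 : 0 ≤ (q * W s t ^ (q - 1) * Real.smoothTransition (R + 1 - y s t ^ 2)) *
      (-(Wt + w * Ws)) :=
    mul_nonneg (mul_nonneg (by positivity) (Real.smoothTransition.nonneg _)) (by linarith)
  push_cast
  linarith

theorem transportOp_barrier_nonpos {w s t : ℝ} (hK : 0 ≤ K)
    (hR : (Vmax * (1 + (1 + T) ^ 2) ^ 2) ^ 2 ≤ R) (hw : 0 ≤ w) (hwV : w ≤ Vmax)
    (ht : t ∈ Icc 0 T) (hs : s ∈ A.dom) :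
    Network.transportOp (A.barrier K Vmax T R q) w s t ≤ 0 := by
  have hV : 0 ≤ Vmax := hw.trans hwV
  have hW : 0 ≤ K + A.escape s + Vmax * (T - t) := by
    have := A.escape_nonneg hs
    have := mul_nonneg hV (sub_nonneg.2 ht.2)
    linarith
  have hWt : HasDerivAt (fun τ => K + A.escape s + Vmax * (T - τ)) (-Vmax) t := by
    simpa using (((hasDerivAt_id t).const_sub T).const_mul Vmax).const_add (K + A.escape s)
  cases A with
  | segment a b L =>
    refine transportOp_mul_smoothTransition_nonpos (W := fun s t => K + 0 + Vmax * (T - t))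
      (y := fun s t => s) (hasDerivAt_const _ _) hWt (hasDerivAt_id s) (hasDerivAt_const _ _) hW
      (by linarith) fun _ => ?_
    have : 0 ≤ s := hs.1
    simp only [zero_add, mul_one]
    positivity
  | rayOut a =>
    refine transportOp_mul_smoothTransition_nonpos (W := fun s t => K + s + Vmax * (T - t))
      (y := fun s t => s) (((hasDerivAt_id s).const_add K).add_const _) hWt (hasDerivAt_id s)
      (hasDerivAt_const _ _) hW (by linarith) fun _ => ?_
    have : 0 ≤ s := hs
    simp only [zero_add, mul_one]
    positivity
  | rayIn b =>
    have hg : HasDerivAt (fun τ : ℝ => s * (1 + (1 + τ) ^ 2)) (s * (2 * (1 + t))) t := by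
      simpa using ((((hasDerivAt_id t).const_add 1).fun_pow 2).const_add 1).const_mul s
    have hgs : HasDerivAt (fun r : ℝ => r * (1 + (1 + t) ^ 2)) (1 + (1 + t) ^ 2) s := by
      simpa using (hasDerivAt_id s).mul_const (1 + (1 + t) ^ 2)
    refine transportOp_mul_smoothTransition_nonpos (W := fun s t => K + -s + Vmax * (T - t))
      (y := fun s t => s * (1 + (1 + t) ^ 2)) (((hasDerivAt_id s).neg.const_add K).add_const _)
      hWt hgs hg hW (by linarith) fun hy => ?_
    have hs' : s ≤ 0 := hs
    obtain ⟨ht0, htT⟩ := ht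
    set g := 1 + (1 + t) ^ 2 with hg_def
    have hg1 : 1 ≤ g := by rw [hg_def]; nlinarith [sq_nonneg (1 + t)]
    have hgG : g ≤ 1 + (1 + T) ^ 2 := by rw [hg_def]; gcongr
    -- far out, `|s|` exceeds `Vmax * g`, and the growth of the factor `g` outweighs the transport
    have h1 : Vmax * (1 + (1 + T) ^ 2) ^ 2 < -s * g := by
      refine lt_of_pow_lt_pow_left₀ 2 (mul_nonneg (by linarith) (by linarith)) ?_
      calc _ ≤ R := hR
        _ < (s * g) ^ 2 := hy
        _ = (-s * g) ^ 2 := by ring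
    have h2 : Vmax * g < -s := by
      have h3 : Vmax * g * g ≤ Vmax * (1 + (1 + T) ^ 2) ^ 2 := by
        rw [mul_assoc, ← sq]
        gcongr
      exact lt_of_mul_lt_mul_right (h3.trans_lt h1) (by linarith)
    have h3 : w * g ≤ Vmax * g := mul_le_mul_of_nonneg_right hwV (by linarith)
    refine mul_nonneg_of_nonpos_of_nonpos (mul_nonpos_of_nonpos_of_nonneg hs' (by linarith)) ?_
    nlinarith

theorem barrier_tail (hR : 0 ≤ R) {i : V} (h : A.tail = some i) (t : ℝ) :
    A.barrier K Vmax T R q 0 t = (K + Vmax * (T - t)) ^ q := by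
  have hc : A.cutParam 0 t = 0 := by cases A <;> simp [cutParam]
  rw [barrier, A.escape_tail h, hc, Real.smoothTransition.one_of_one_le (by simpa using hR)]
  simp

theorem barrier_head (hR : 0 ≤ R) (hL : A.headParam ^ 2 ≤ R) {i : V} (h : A.head = some i)
    (t : ℝ) : A.barrier K Vmax T R q A.headParam t = (K + Vmax * (T - t)) ^ q := by
  have hc : A.cutParam A.headParam t ^ 2 ≤ R := by
    cases A <;> simp_all [cutParam, headParam]
  rw [barrier, A.escape_head h, Real.smoothTransition.one_of_one_le (by linarith)]
  simp

theorem barrier_nonneg (hK : 0 ≤ K) (hV : 0 ≤ Vmax) {s t : ℝ} (hs : s ∈ A.dom) (ht : t ≤ T) :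
    0 ≤ A.barrier K Vmax T R q s t := by
  have := A.escape_nonneg hs
  have := mul_nonneg hV (sub_nonneg.2 ht)
  exact mul_nonneg (pow_nonneg (by linarith) q) (Real.smoothTransition.nonneg _)

theorem barrier_le (hK : 0 ≤ K) (hV : 0 ≤ Vmax) {s t : ℝ} (hs : s ∈ A.dom) (ht : t ≤ T) :
    A.barrier K Vmax T R q s t ≤ (K + A.escape s + Vmax * (T - t)) ^ q := by
  have := A.escape_nonneg hs
  have := mul_nonneg hV (sub_nonneg.2 ht)
  exact mul_le_of_le_one_right (pow_nonneg (by linarith) q) (Real.smoothTransition.le_one _)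

end ArcShape

/-! ### Test functions and integrals over the network -/

namespace Network

variable {d : ℕ} {V J : Type*} (G : Network d V J)

/-- For large `R` the functions `ArcShape.barrier` on the arcs are one test function on the
network. -/
theorem exists_testFunction_barrier {K Vmax T R : ℝ} {q : ℕ} (hR : 0 ≤ R)
    (hL : ∀ j, (G.shape j).headParam ^ 2 ≤ R) :
    ∃ f : G.TestFunction, (∀ j, f.ext j = (G.shape j).barrier K Vmax T R q) ∧
      ∀ (i : V) t, f.toFun (G.vertex i) t = (K + Vmax * (T - t)) ^ q := by
  obtain ⟨h, hh⟩ := G.exists_glue (fun j => (G.shape j).barrier K Vmax T R q)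
    (fun _ t => (K + Vmax * (T - t)) ^ q)
    (fun j i hi => funext fun t => (G.shape j).barrier_tail hR hi t)
    (fun j i hi => funext fun t => (G.shape j).barrier_head hR (hL j) hi t)
  refine ⟨⟨h, fun j => (G.shape j).barrier K Vmax T R q, fun j => (G.shape j).contDiff_barrier,
    ⟨R + 1, fun j s t hs => (G.shape j).barrier_eq_zero hR hs t⟩,
    fun j s t => congrFun (hh j s) t⟩, fun _ => rfl, fun i t => ?_⟩
  obtain ⟨j, hj⟩ := G.no_sink i
  change h (G.vertex i) t = _
  rw [← G.arc_tail hj, hh]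
  exact (G.shape j).barrier_tail hR hj t

theorem integrable_ext (f : G.TestFunction) (t : ℝ) (j : J) (μ : FiniteMeasure (G.dom j)) :
    Integrable (fun s : G.dom j => f.ext j s t) (μ : Measure (G.dom j)) := by
  have hc : Continuous fun s => f.ext j s t :=
    (f.ext_smooth j).continuous.comp (by fun_prop : Continuous fun s : ℝ => (s, t))
  obtain ⟨R, hR⟩ := f.ext_support
  have hsupp : HasCompactSupport fun s => f.ext j s t :=
    HasCompactSupport.intro (isCompact_Icc (a := -R) (b := R)) fun s hs =>
      hR j s t (not_le.1 fun h => hs (abs_le.1 h))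
  obtain ⟨B, hB⟩ := hsupp.exists_bound_of_continuous hc
  exact Integrable.of_bound (hc.comp continuous_subtype_val).aestronglyMeasurable B
    (.of_forall fun s => hB s)

variable [Fintype J]

theorem toMeasure_total (m : G.ArcMeasures) :
    (G.total m : Measure G.Pt) = ∑ j, (m j : Measure (G.dom j)).map (G.arc j) := by
  simp [total, FiniteMeasure.toMeasure_sum]

theorem lintegral_total (m : G.ArcMeasures) (f : G.Pt → ℝ≥0∞) :
    ∫⁻ x, f x ∂(G.total m : Measure G.Pt) =
      ∑ j, ∫⁻ s, f (G.arc j s) ∂(m j : Measure (G.dom j)) := by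
  rw [toMeasure_total, lintegral_finsetSum_measure]
  exact Finset.sum_congr rfl fun j _ => (G.measurableEmbedding_arc j).lintegral_map f

theorem integral_total_testFunction (m : G.ArcMeasures) (f : G.TestFunction) (t : ℝ) :
    ∫ x, f.toFun x t ∂(G.total m : Measure G.Pt) =
      ∑ j, ∫ s : G.dom j, f.ext j s t ∂(m j : Measure (G.dom j)) := by
  rw [toMeasure_total, integral_finsetSum_measure]
  · refine Finset.sum_congr rfl fun j _ => ?_
    rw [(G.measurableEmbedding_arc j).integral_map]
    simp only [f.toFun_arc]
  · intro j _
    rw [(G.measurableEmbedding_arc j).integrable_map_iff]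
    simp only [Function.comp_def, f.toFun_arc]
    exact G.integrable_ext f t j (m j)

end Network

/-! ### Masses and dual norms -/

/-- The dual bounded Lipschitz norm of a positive functional is at least its value at the constant
function `1`: the functional is bounded on the unit ball, so the supremum is not a junk value. -/
theorem le_blNorm {X : Type*} {dist : X → X → ℝ} {F : (X → ℝ) → ℝ} {M : ℝ}
    (hF : ∀ φ : X → ℝ, (∀ x, |φ x| ≤ 1) → |F φ| ≤ M) : F (fun _ => 1) ≤ blNorm dist F := by
  refine (le_abs_self _).trans (le_csSup ⟨M, ?_⟩ ?_)
  · rintro r ⟨φ, A, B, hA, hB, hAB, hφ, -, rfl⟩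
    exact hF φ fun x => (hφ x).trans (by linarith)
  · exact ⟨fun _ => 1, 1, 0, zero_le_one, le_rfl, by simp, by simp, by simp, rfl⟩

namespace Network

variable {d : ℕ} {V J : Type*} (G : Network d V J)

theorem mass_le_normBL (m : FiniteMeasure G.Pt) :
    (m : Measure G.Pt).real univ ≤ G.normBL m := by
  have := le_blNorm (dist := G.pathDist) (F := fun φ => ∫ x, φ x ∂(m : Measure G.Pt))
    (M := (m : Measure G.Pt).real univ) fun φ hφ => by
      simpa using norm_integral_le_of_norm_le_const (μ := (m : Measure G.Pt))
        (C := 1) (f := φ) (.of_forall hφ)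
  simpa [normBL] using this

theorem mass_le_normBLBoundary [Finite V] {T : ℝ} (σ : G.Source → FiniteMeasure (Icc (0 : ℝ) T)) :
    ∑ i, (σ i : Measure (Icc (0 : ℝ) T)).real univ ≤ G.normBLBoundary σ := by
  have := le_blNorm
    (dist := fun z w : G.Pt × Icc (0 : ℝ) T => G.pathDist z.1 w.1 + |(z.2 : ℝ) - w.2|)
    (F := fun φ => ∑ i, ∫ t, φ (G.vertex i.1, t) ∂(σ i : Measure (Icc (0 : ℝ) T)))
    (M := ∑ i, (σ i : Measure (Icc (0 : ℝ) T)).real univ) fun φ hφ => by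
      refine (Finset.abs_sum_le_sum_abs _ _).trans (Finset.sum_le_sum fun i _ => ?_)
      simpa using norm_integral_le_of_norm_le_const (μ := (σ i : Measure (Icc (0 : ℝ) T)))
        (C := 1) (f := fun t => φ (G.vertex i.1, t)) (.of_forall fun t => hφ (G.vertex i.1, t))
  simpa [normBLBoundary] using this

/-! ### The weighted mass of an approximation -/

/-- The boundary mass that has entered before the time `t`. -/
noncomputable def enteredMass [Finite V] {T : ℝ} (σ : G.Source → FiniteMeasure (Icc (0 : ℝ) T))
    (t : ℝ) : ℝ :=
  ∑ i, (σ i : Measure (Icc (0 : ℝ) T)).real {τ | (τ : ℝ) < t}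

theorem enteredMass_sub [Finite V] {T : ℝ} (σ : G.Source → FiniteMeasure (Icc (0 : ℝ) T))
    {a t : ℝ} (hat : a ≤ t) :
    ∑ i, (σ i : Measure (Icc (0 : ℝ) T)).real {τ | a ≤ (τ : ℝ) ∧ (τ : ℝ) < t} =
      G.enteredMass σ t - G.enteredMass σ a := by
  rw [enteredMass, enteredMass, ← Finset.sum_sub_distrib]
  refine Finset.sum_congr rfl fun i _ => ?_
  rw [← measureReal_sdiff]
  · congr 1
    ext τ
    simp [and_comm]
  · exact fun τ hτ => lt_of_lt_of_le hτ hat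
  · exact measurableSet_lt measurable_subtype_coe measurable_const

/-- The integral of the cut-off weight at time `t`. -/
noncomputable def barrierMass [Fintype J] (K Vmax T R : ℝ) (q : ℕ) (m : G.ArcMeasures) (t : ℝ) :
    ℝ :=
  ∑ j, ∫ s : G.dom j, (G.shape j).barrier K Vmax T R q s t ∂(m j : Measure (G.dom j))

variable [Fintype J] {K Vmax T R : ℝ} {q : ℕ}

/-- `R` is so large that the cutoff affects neither the vertices nor the monotonicity of the
weight along characteristics. -/
structure IsLargeCutoff (Vmax T R : ℝ) : Prop where
  headParam_sq_le : ∀ j, (G.shape j).headParam ^ 2 ≤ R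
  le : (Vmax * (1 + (1 + T) ^ 2) ^ 2) ^ 2 ≤ R

/-- The cut-off weight has nonpositive transport derivative, so its integral can only grow through
the mass entering at the sources. -/
theorem IsLinearSolution.barrierMass_le [Finite V] [DecidableEq V] {p : J → J → ℝ → ℝ}
    {σ : G.Source → FiniteMeasure (Icc (0 : ℝ) T)} {w : ∀ j, G.dom j → ℝ} {a b : ℝ}
    {m : ℝ → G.ArcMeasures} (h : G.IsLinearSolution p σ w a b m) (hK : 0 ≤ K) (hV : 0 ≤ Vmax)
    (hR : G.IsLargeCutoff Vmax T R) (hw : ∀ j s, 0 ≤ w j s) (hwV : ∀ j s, w j s ≤ Vmax)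
    (ha : 0 ≤ a) (hb : b ≤ T) {t : ℝ} (ht : t ∈ Icc a b) :
    G.barrierMass K Vmax T R q (m t) t ≤ G.barrierMass K Vmax T R q (m a) a +
      (K + Vmax * T) ^ q * (G.enteredMass σ t - G.enteredMass σ a) := by
  obtain ⟨f, hf, hfv⟩ := G.exists_testFunction_barrier (K := K) (Vmax := Vmax) (T := T) (q := q)
    ((sq_nonneg _).trans hR.le) hR.headParam_sq_le
  have hbal := h.balance f t ht
  rw [G.integral_total_testFunction, G.integral_total_testFunction] at hbal
  simp only [hf, hfv] at hbal
  have htransport : ∫ τ in a..t, ∑ j, ∫ s : G.dom j,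
      transportOp ((G.shape j).barrier K Vmax T R q) (w j s) s τ
        ∂(m τ j : Measure (G.dom j)) ≤ 0 := by
    rw [intervalIntegral.integral_of_le ht.1]
    refine setIntegral_nonpos measurableSet_Ioc fun τ hτ => Finset.sum_nonpos fun j _ =>
      integral_nonpos fun s => ?_
    exact (G.shape j).transportOp_barrier_nonpos hK hR.le (hw j s) (hwV j s)
      ⟨ha.trans hτ.1.le, hτ.2.trans (ht.2.trans hb)⟩ s.2
  have hsource : ∑ i, ∫ τ in {τ : Icc (0 : ℝ) T | a ≤ (τ : ℝ) ∧ (τ : ℝ) < t},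
      (K + Vmax * (T - τ)) ^ q ∂(σ i : Measure (Icc (0 : ℝ) T)) ≤
      (K + Vmax * T) ^ q * (G.enteredMass σ t - G.enteredMass σ a) := by
    rw [← G.enteredMass_sub σ ht.1, Finset.mul_sum]
    refine Finset.sum_le_sum fun i _ => (le_abs_self _).trans ?_
    rw [← Real.norm_eq_abs]
    refine norm_setIntegral_le_of_norm_le_const
      (μ := (σ i : Measure (Icc (0 : ℝ) T))) (measure_lt_top _ _) fun τ _ => ?_
    have h1 : 0 ≤ Vmax * (T - τ) := mul_nonneg hV (sub_nonneg.2 τ.2.2)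
    rw [Real.norm_of_nonneg (by positivity)]
    gcongr
    linarith [τ.2.1]
  unfold barrierMass
  linarith

theorem IsApproximation.barrierMass_le [Finite V] [DecidableEq V] (hT : 0 ≤ T)
    {v : FiniteMeasure G.Pt → ∀ j, G.dom j → ℝ} {p : J → J → ℝ → ℝ} {m₀ : G.ArcMeasures}
    {σ : G.Source → FiniteMeasure (Icc (0 : ℝ) T)} {N : ℕ} {m : ℝ → G.ArcMeasures}
    (h : G.IsApproximation v p m₀ σ N m) (hv : G.IsVelocityField Vmax v) (hK : 0 ≤ K)
    (hV : 0 ≤ Vmax) (hR : G.IsLargeCutoff Vmax T R) {t : ℝ} (ht : t ∈ Icc 0 T) :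
    G.barrierMass K Vmax T R q (m t) t ≤ G.barrierMass K Vmax T R q m₀ 0 +
      (K + Vmax * T) ^ q * G.enteredMass σ t := by
  set δ := T / 2 ^ N with hδ
  have hδ0 : 0 ≤ δ := by positivity
  have hδT : (2 ^ N : ℕ) * δ = T := by
    rw [hδ]; push_cast; field_simp
  have hstep : ∀ n : ℕ, n < 2 ^ N → ∀ t ∈ Icc (n * δ) ((n + 1) * δ),
      G.barrierMass K Vmax T R q (m t) t ≤ G.barrierMass K Vmax T R q (m (n * δ)) (n * δ) +
        (K + Vmax * T) ^ q * (G.enteredMass σ t - G.enteredMass σ (n * δ)) := by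
    intro n hn t ht
    refine (h.step n hn).barrierMass_le G hK hV hR (hv.nonneg _) (hv.le_max _) (by positivity)
      ?_ ht
    calc ((n : ℝ) + 1) * δ ≤ (2 ^ N : ℕ) * δ := by
          gcongr
          exact_mod_cast hn
      _ = T := hδT
  have hgrid : ∀ n : ℕ, n ≤ 2 ^ N →
      G.barrierMass K Vmax T R q (m (n * δ)) (n * δ) ≤ G.barrierMass K Vmax T R q m₀ 0 +
        (K + Vmax * T) ^ q * G.enteredMass σ (n * δ) := by
    intro n
    induction n with
    | zero =>
      intro _
      have : G.enteredMass σ 0 = 0 := by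
        refine Finset.sum_eq_zero fun i _ => ?_
        have : {τ : Icc (0 : ℝ) T | (τ : ℝ) < 0} = ∅ :=
          eq_empty_of_forall_notMem fun τ hτ => not_le.2 hτ τ.2.1
        rw [this, measureReal_empty]
      simp [this, h.initial]
    | succ n ih =>
      intro hn
      have h1 := hstep n hn ((n + 1 : ℕ) * δ) (by
        push_cast
        exact right_mem_Icc.2 (by gcongr; linarith))
      linarith [ih (Nat.le_of_succ_le hn)]
  -- the endpoint `T` belongs to the last step
  obtain ⟨n, hn, hnt⟩ : ∃ n : ℕ, n < 2 ^ N ∧ t ∈ Icc (n * δ) ((n + 1) * δ) := by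
    have hex : ∃ n : ℕ, t ≤ (n + 1) * δ := by
      refine ⟨2 ^ N, ht.2.trans ?_⟩
      rw [add_mul, hδT]
      linarith
    classical
    refine ⟨Nat.find hex, ?_, ?_, Nat.find_spec hex⟩
    · have hpos : 0 < 2 ^ N := by positivity
      have : Nat.find hex ≤ 2 ^ N - 1 := by
        refine Nat.find_min' hex (ht.2.trans (le_of_eq ?_))
        rw [← hδT, Nat.cast_sub hpos]
        simp
      omega
    · rcases hm : Nat.find hex with _ | k
      · simpa using ht.1
      · have := Nat.find_min hex (m := k) (by omega)
        push_cast
        exact (not_le.1 this).le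
  linarith [hstep n hn t hnt, hgrid n hn.le]

theorem ofReal_barrierMass (hK : 0 ≤ K) (hV : 0 ≤ Vmax) (hR : G.IsLargeCutoff Vmax T R)
    (m : G.ArcMeasures) {t : ℝ} (ht : t ≤ T) :
    ENNReal.ofReal (G.barrierMass K Vmax T R q m t) =
      ∑ j, ∫⁻ s : G.dom j, ENNReal.ofReal ((G.shape j).barrier K Vmax T R q s t)
        ∂(m j : Measure (G.dom j)) := by
  obtain ⟨f, hf, -⟩ := G.exists_testFunction_barrier (K := K) (Vmax := Vmax) (T := T) (q := q)
    ((sq_nonneg _).trans hR.le) hR.headParam_sq_le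
  have h0 : ∀ j (s : G.dom j), 0 ≤ (G.shape j).barrier K Vmax T R q s t := fun j s =>
    (G.shape j).barrier_nonneg hK hV s.2 ht
  rw [barrierMass, ENNReal.ofReal_sum_of_nonneg fun j _ => integral_nonneg (h0 j)]
  refine Finset.sum_congr rfl fun j _ => ?_
  refine ofReal_integral_eq_lintegral_ofReal ?_ (.of_forall (h0 j))
  rw [← hf j]
  exact G.integrable_ext f t j (m j)

/-- Removal of the cutoff by monotone convergence: bounds on the cut-off weights that are uniform in
the cutoff carry over to the full weight. -/
theorem lintegral_weight_le (hK : 0 ≤ K) (hV : 0 ≤ Vmax) (m : G.ArcMeasures) {t : ℝ}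
    (ht : t ≤ T) {B : ℝ≥0∞}
    (hB : ∀ R, G.IsLargeCutoff Vmax T R →
      ENNReal.ofReal (G.barrierMass K Vmax T R q m t) ≤ B) :
    ∑ j, ∫⁻ s : G.dom j, ENNReal.ofReal ((K + (G.shape j).escape s + Vmax * (T - t)) ^ q)
      ∂(m j : Measure (G.dom j)) ≤ B := by
  obtain ⟨R₀, hR₀⟩ := (Set.finite_range fun j => (G.shape j).headParam ^ 2).bddAbove
  set R₁ := max R₀ ((Vmax * (1 + (1 + T) ^ 2) ^ 2) ^ 2)
  have hlarge : ∀ n : ℕ, G.IsLargeCutoff Vmax T (R₁ + n) := fun n =>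
    ⟨fun j => ((hR₀ (mem_range_self j)).trans (le_max_left _ _)).trans
      (le_add_of_nonneg_right n.cast_nonneg),
      (le_max_right _ _).trans (le_add_of_nonneg_right n.cast_nonneg)⟩
  refine le_of_tendsto' (f := fun n : ℕ => ∑ j, ∫⁻ s : G.dom j,
    ENNReal.ofReal ((G.shape j).barrier K Vmax T (R₁ + n) q s t) ∂(m j : Measure (G.dom j)))
    (x := Filter.atTop) (tendsto_finsetSum _ fun j _ => ?_) fun n => ?_
  · refine lintegral_tendsto_of_tendsto_of_monotone (fun n => ?_) (.of_forall fun s => ?_)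
      (.of_forall fun s => ?_)
    · have hc : Continuous fun s => (G.shape j).barrier K Vmax T (R₁ + n) q s t :=
        (G.shape j).contDiff_barrier.continuous.comp
          (by fun_prop : Continuous fun s : ℝ => (s, t))
      exact (hc.measurable.comp measurable_subtype_coe).ennreal_ofReal.aemeasurable
    · intro n n' hn
      have h1 := (G.shape j).escape_nonneg s.2
      have h2 := mul_nonneg hV (sub_nonneg.2 ht)
      refine ENNReal.ofReal_le_ofReal (mul_le_mul_of_nonneg_left
        (Real.smoothTransition.monotone ?_) (pow_nonneg (by linarith) q))
      gcongr
    · refine tendsto_const_nhds.congr' ?_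
      obtain ⟨n₀, hn₀⟩ := exists_nat_ge ((G.shape j).cutParam s t ^ 2 - R₁)
      filter_upwards [Filter.eventually_ge_atTop n₀] with n hn
      have : (n₀ : ℝ) ≤ n := by exact_mod_cast hn
      rw [ArcShape.barrier, Real.smoothTransition.one_of_one_le (by linarith), mul_one]
  · rw [← G.ofReal_barrierMass hK hV (hlarge n) m ht]
    exact hB _ (hlarge n)

theorem barrierMass_zero_le (hK : 0 ≤ K) (hV : 0 ≤ Vmax) (hT : 0 ≤ T)
    (hR : G.IsLargeCutoff Vmax T R) (m : G.ArcMeasures) :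
    ENNReal.ofReal (G.barrierMass K Vmax T R q m 0) ≤
      ∑ j, ∫⁻ s : G.dom j, ENNReal.ofReal ((K + (G.shape j).escape s + Vmax * T) ^ q)
        ∂(m j : Measure (G.dom j)) := by
  rw [G.ofReal_barrierMass hK hV hR m hT]
  gcongr with j _ s
  simpa using (G.shape j).barrier_le hK hV s.2 hT

/-- The weighted mass of an approximation: the weight `(K + escape + Vmax (T - t)) ^ q` decreases
along all trajectories of speed at most `Vmax`. -/
theorem IsApproximation.lintegral_weight_le [Finite V] [DecidableEq V] (hT : 0 ≤ T)
    {v : FiniteMeasure G.Pt → ∀ j, G.dom j → ℝ} {p : J → J → ℝ → ℝ} {m₀ : G.ArcMeasures}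
    {σ : G.Source → FiniteMeasure (Icc (0 : ℝ) T)} {N : ℕ} {m : ℝ → G.ArcMeasures}
    (h : G.IsApproximation v p m₀ σ N m) (hv : G.IsVelocityField Vmax v) (hK : 0 ≤ K)
    (hV : 0 ≤ Vmax) {t : ℝ} (ht : t ∈ Icc 0 T) :
    ∑ j, ∫⁻ s : G.dom j, ENNReal.ofReal ((K + (G.shape j).escape s + Vmax * (T - t)) ^ q)
        ∂(m t j : Measure (G.dom j)) ≤
      ∑ j, ∫⁻ s : G.dom j, ENNReal.ofReal ((K + (G.shape j).escape s + Vmax * T) ^ q)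
        ∂(m₀ j : Measure (G.dom j)) +
      ENNReal.ofReal ((K + Vmax * T) ^ q * G.normBLBoundary σ) := by
  refine G.lintegral_weight_le hK hV (m t) ht.2 fun R hR => ?_
  refine (ENNReal.ofReal_le_ofReal (h.barrierMass_le G hT hv hK hV hR ht)).trans ?_
  refine ENNReal.ofReal_add_le.trans (add_le_add (G.barrierMass_zero_le hK hV hT hR m₀) ?_)
  refine ENNReal.ofReal_le_ofReal (mul_le_mul_of_nonneg_left ?_ (by positivity))
  refine le_trans (Finset.sum_le_sum fun i _ => ?_) (G.mass_le_normBLBoundary σ)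
  exact measureReal_mono (subset_univ _)

end Network

/-! ### The moment bound -/

theorem mainTheorem7 {d : ℕ} {V J : Type*} [Fintype V] [DecidableEq V] [Fintype J]
    (G : Network d V J) (o : G.Pt) :
    ∃ C : ℝ → ℝ → ℝ → ℝ → ℝ, (∀ T Vmax M S, 0 < C T Vmax M S) ∧
      ∀ (T Vmax : ℝ), 0 < T → 0 < Vmax →
      ∀ v : FiniteMeasure G.Pt → ∀ j, G.dom j → ℝ, G.IsVelocityField Vmax v →
      ∀ p : J → J → ℝ → ℝ, G.IsDistributionMatrix T p →
      ∀ (m₀ : G.ArcMeasures) (σ : G.Source → FiniteMeasure (Set.Icc (0 : ℝ) T)),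
      (∀ q ∈ ({1, 2} : Set ℕ), G.moment q o (G.total m₀) < ⊤) →
      ∀ (N : ℕ) (m : ℝ → G.ArcMeasures), G.IsApproximation v p m₀ σ N m →
      ∀ t ∈ Set.Icc 0 T, ∀ q ∈ ({1, 2} : Set ℕ),
        G.moment q o (G.total (m t)) < ⊤ ∧
        G.moment q o (G.total (m t)) ≤
          ENNReal.ofReal (C T Vmax (G.normBL (G.total m₀)) (G.normBLBoundary σ)) *
            (1 + G.moment q o (G.total m₀)) := by
  obtain ⟨K, hK1, hK⟩ := G.exists_pathDist_le_escape_add o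
  obtain ⟨K', hK'0, hK'⟩ := G.exists_escape_le_pathDist_add o
  let A : ℝ → ℝ → ℝ := fun T Vmax => K + K' + |Vmax| * |T|
  -- the absolute values make the constant positive for all values of its arguments
  refine ⟨fun T Vmax M S => 2 + 2 * A T Vmax ^ 2 * |M| + A T Vmax ^ 2 * |S|,
    fun T Vmax M S => by positivity, ?_⟩
  intro T Vmax hT hV v hv p _ m₀ σ hm₀ N m hm t ht q hq
  set a := A T Vmax with ha
  have ha' : a = K + K' + Vmax * T := by
    rw [ha]; simp only [A]; rw [abs_of_pos hV, abs_of_pos hT]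
  have hVT : 0 < Vmax * T := mul_pos hV hT
  set M := G.normBL (G.total m₀)
  set S := G.normBLBoundary σ
  suffices h : G.moment q o (G.total (m t)) ≤
      ENNReal.ofReal (2 + 2 * a ^ 2 * |M| + a ^ 2 * |S|) *
        (1 + G.moment q o (G.total m₀)) from
    ⟨h.trans_lt (ENNReal.mul_lt_top ENNReal.ofReal_lt_top
      (ENNReal.add_lt_top.2 ⟨ENNReal.one_lt_top, hm₀ q hq⟩)), h⟩
  have hpow : ∀ x : ℝ, 1 ≤ x → x ^ q ≤ x ^ 2 := fun x hx => by
    refine pow_le_pow_right₀ hx ?_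
    rcases hq with rfl | rfl <;> norm_num
  have hmoment : G.moment q o (G.total (m t)) ≤ ∑ j, ∫⁻ s : G.dom j,
      ENNReal.ofReal ((K + (G.shape j).escape s + Vmax * (T - t)) ^ q)
        ∂(m t j : Measure (G.dom j)) := by
    rw [Network.moment, G.lintegral_total]
    gcongr with j _ s
    · exact G.pathDist_nonneg _ _
    · have := mul_nonneg hV.le (sub_nonneg.2 ht.2)
      linarith [hK j s]
  have hinit : ∑ j, ∫⁻ s : G.dom j, ENNReal.ofReal ((K + (G.shape j).escape s + Vmax * T) ^ q)
      ∂(m₀ j : Measure (G.dom j)) ≤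
      2 * G.moment q o (G.total m₀) + ENNReal.ofReal (2 * a ^ 2 * M) := by
    calc _ ≤ ∫⁻ x, (ENNReal.ofReal (2 * a ^ 2) + 2 * ENNReal.ofReal (G.pathDist x o ^ q))
          ∂(G.total m₀ : Measure G.Pt) := by
          rw [G.lintegral_total]
          gcongr with j _ s
          have hd := G.pathDist_nonneg (G.arc j s) o
          have hw : K + (G.shape j).escape s + Vmax * T ≤ a + G.pathDist (G.arc j s) o := by
            linarith [hK' j s]
          rw [← ENNReal.ofReal_ofNat 2, ← ENNReal.ofReal_mul (by norm_num),
            ← ENNReal.ofReal_add (by positivity) (by positivity)]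
          refine ENNReal.ofReal_le_ofReal ((pow_le_pow_left₀ ?_ hw q).trans ?_)
          · linarith [(G.shape j).escape_nonneg s.2]
          · rcases hq with rfl | rfl
            · nlinarith
            · nlinarith [sq_nonneg (a - G.pathDist (G.arc j s) o)]
      _ = ENNReal.ofReal (2 * a ^ 2) * (G.total m₀ : Measure G.Pt) univ +
            2 * G.moment q o (G.total m₀) := by
          rw [lintegral_add_left measurable_const, lintegral_const,
            lintegral_const_mul' _ _ ENNReal.ofNat_ne_top]
          rfl
      _ ≤ _ := by
          rw [add_comm]
          gcongr
          rw [← ofReal_measureReal, ← ENNReal.ofReal_mul (by positivity)]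
          exact ENNReal.ofReal_le_ofReal
            (mul_le_mul_of_nonneg_left (G.mass_le_normBL _) (by positivity))
  have hsource : ENNReal.ofReal ((K + Vmax * T) ^ q * S) ≤ ENNReal.ofReal (a ^ 2 * |S|) := by
    refine ENNReal.ofReal_le_ofReal ?_
    calc (K + Vmax * T) ^ q * S ≤ (K + Vmax * T) ^ q * |S| := by
          gcongr
          exact le_abs_self S
      _ ≤ (K + Vmax * T) ^ 2 * |S| := by
          gcongr 1
          exact hpow _ (by linarith)
      _ ≤ a ^ 2 * |S| := by
          gcongr
          linarith
  have hM : 0 ≤ 2 * a ^ 2 * |M| := by positivity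
  have hS : 0 ≤ a ^ 2 * |S| := by positivity
  calc G.moment q o (G.total (m t))
      ≤ 2 * G.moment q o (G.total m₀) + ENNReal.ofReal (2 * a ^ 2 * M) +
          ENNReal.ofReal ((K + Vmax * T) ^ q * S) :=
        hmoment.trans ((hm.lintegral_weight_le G hT.le hv (by linarith) hV.le ht).trans
          (add_le_add_left hinit _))
    _ ≤ 2 * G.moment q o (G.total m₀) + ENNReal.ofReal (2 * a ^ 2 * |M|) +
          ENNReal.ofReal (a ^ 2 * |S|) := by
        gcongr
        exact le_abs_self M
    _ = 2 * G.moment q o (G.total m₀) + ENNReal.ofReal (2 * a ^ 2 * |M| + a ^ 2 * |S|) * 1 := by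
        rw [mul_one, ENNReal.ofReal_add hM hS, add_assoc]
    _ ≤ (2 + ENNReal.ofReal (2 * a ^ 2 * |M| + a ^ 2 * |S|)) * G.moment q o (G.total m₀) +
          (2 + ENNReal.ofReal (2 * a ^ 2 * |M| + a ^ 2 * |S|)) * 1 := by
        gcongr
        · exact le_self_add
        · exact le_add_self
    _ = _ := by
        rw [← mul_add, add_comm _ 1, add_assoc (2 : ℝ), ENNReal.ofReal_add zero_le_two
          (add_nonneg hM hS), ENNReal.ofReal_ofNat]
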